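/- Let $m\ge 0$ and let $\mathbb{P}$ be a probability measure on $\mathbb{R}\times\mathbb{R}^m$ with bounded support and with a density with respect to Lebesgue measure. Let $(b_1,\mathbf r_1),(b_2,\mathbf r_2),\dots$ be i.i.d. samples from $\mathbb{P}$, and let $\mathcal S_n$ consist of the first $n$ of them. Let $(c_n)_{n\ge1}$ be positive reals with $c_n\downarrow 0$ and $\lim_{n\to\infty} n\,c_n^{m+1}=\infty$. For every $n\ge 1$ let $\mathbf x(c_n,\mathcal S_n)$ be a Lasso solution, that is, any minimizer over $\mathbf x\in\mathbb{R}^m$ of $$\sqrt{\frac1n\sum_{i=1}^n\bigl(b_i-\mathbf r_i^\top\mathbf x\bigr)^2}+c_n\|\mathbf x\|_1 ,$$ and suppose that almost surely there is a constant $H$ (possibly depending on the realization of the samples) such that $\|\mathbf x(c_n,\mathcal S_n)\|_2\le H$ for all $n\ge1$. Then the true risk $\mathbf x\mapsto\sqrt{\int (b-\mathbf r^\top\mathbf x)^2\,d\mathbb{P}(b,\mathbf r)}$ has a minimizer over $\mathbb{R}^m$, and for every minimizer $\mathbf x(\mathbb{P})$, $$\lim_{n\to\infty}\sqrt{\int \bigl(b-\mathbf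 r^\top\mathbf x(c_n,\mathcal S_n)\bigr)^2\,d\mathbb{P}(b,\mathbf r)}=\sqrt{\int \bigl(b-\mathbf r^\top\mathbf x(\mathbb{P})\bigr)^2\,d\mathbb{P}(b,\mathbf r)}\qquad\text{almost surely.}$$ -/

import Mathlib

open MeasureTheory ProbabilityTheory Filter Topology

/-- Observations `z = (b, r)`: a response `b ∈ ℝ` and a feature vector `r ∈ ℝᵐ`. -/
abbrev Obs (m : ℕ) : Type := ℝ × EuclideanSpace ℝ (Fin m)

/-- The residual `b - rᵀ x` of the linear predictor `x` at the observation `z = (b, r)`. -/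
noncomputable def predResidual {m : ℕ} (z : Obs m) (x : EuclideanSpace ℝ (Fin m)) : ℝ :=
  z.1 - ∑ j, z.2 j * x j

/-- The Lasso objective
`√((1/n) ∑ᵢ (bᵢ - rᵢᵀ x)²) + c ‖x‖₁` for the `n` observations `S` and the parameter `c`. -/
noncomputable def lassoObjective {m n : ℕ} (c : ℝ) (S : Fin n → Obs m)
    (x : EuclideanSpace ℝ (Fin m)) : ℝ :=
  √((1 / (n : ℝ)) * ∑ i, predResidual (S i) x ^ 2) + c * ∑ j, |x j|

/-- `x` is a Lasso solution: a (global) minimizer of the Lasso objective over `ℝᵐ`. -/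
def IsLassoSolution {m n : ℕ} (c : ℝ) (S : Fin n → Obs m)
    (x : EuclideanSpace ℝ (Fin m)) : Prop :=
  ∀ y : EuclideanSpace ℝ (Fin m), lassoObjective c S x ≤ lassoObjective c S y

/-- The true risk `√(∫ (b - rᵀ x)² dP(b, r))` of the predictor `x`. -/
noncomputable def trueRisk {m : ℕ} (P : Measure (Obs m)) (x : EuclideanSpace ℝ (Fin m)) : ℝ :=
  √(∫ z, predResidual z x ^ 2 ∂P)

/-- `x` is a true optimal solution: a (global) minimizer of the true risk over `ℝᵐ`. -/
def IsOptimalSolution {m : ℕ} (P : Measure (Obs m)) (x : EuclideanSpace ℝ (Fin m)) : Prop :=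
  ∀ y : EuclideanSpace ℝ (Fin m), trueRisk P x ≤ trueRisk P y

/-!
All residuals lie in one finite-dimensional space of square-integrable functions. Expanding in an
`L²(P)`-orthonormal basis of this space and applying the strong law of large numbers to the finitely
many products of basis functions shows that almost surely, for all predictors simultaneously, the
empirical mean square of the residual differs from the true one by at most `δ n` times the true one,
with `δ n → 0`. This relative error bound is uniform over all of `ℝᵐ`, so it applies to the Lasso
solutions wherever they lie: comparing them with a fixed optimal solution, whose penalty tends to
`0`, gives the limit. The same finite-dimensionality yields an optimal solution by orthogonal
projection in `L²(P)`.
-/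

open scoped InnerProductSpace

section InnerProduct

variable {𝕜 V F : Type*} [RCLike 𝕜] [AddCommGroup V] [Module 𝕜 V] [NormedAddCommGroup F]
  [InnerProductSpace 𝕜 F]

theorem exists_forall_norm_sub_le (L : V →ₗ[𝕜] F) [(LinearMap.range L).HasOrthogonalProjection]
    (b : F) : ∃ v, ∀ w, ‖b - L v‖ ≤ ‖b - L w‖ := by
  obtain ⟨v, hv⟩ := (LinearMap.range L).starProjection_apply_mem b
  refine ⟨v, fun w => ?_⟩
  rw [hv, Submodule.starProjection_minimal]
  exact ciInf_le ⟨0, by rintro _ ⟨u, rfl⟩; exact norm_nonneg _⟩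
    (⟨L w, LinearMap.mem_range_self L w⟩ : LinearMap.range L)

theorem exists_orthonormal_comp_sum_inner_smul_eq (L : V →ₗ[𝕜] F)
    [FiniteDimensional 𝕜 (LinearMap.range L)] :
    ∃ (d : ℕ) (e : Fin d → V), Orthonormal 𝕜 (fun k => L (e k)) ∧
      ∀ v, ∑ k, ⟪L (e k), L v⟫_𝕜 • L (e k) = L v := by
  let u := stdOrthonormalBasis 𝕜 (LinearMap.range L)
  choose e he using fun k => (u k).2
  refine ⟨_, e, ?_, fun v => ?_⟩
  · simp_rw [he]
    exact u.orthonormal.comp_linearIsometry (LinearMap.range L).subtypeₗᵢ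
  · have h := congrArg Subtype.val (u.sum_repr' ⟨L v, LinearMap.mem_range_self L v⟩)
    simpa [he] using h

end InnerProduct

theorem norm_sq_eq_sum_inner_mul {ι F : Type*} [Fintype ι] [NormedAddCommGroup F]
    [InnerProductSpace ℝ F] {w : ι → F} {y : F} (h : ∑ k, ⟪w k, y⟫_ℝ • w k = y) :
    ‖y‖ ^ 2 = ∑ k, ∑ l, ⟪w k, w l⟫_ℝ * (⟪w k, y⟫_ℝ * ⟪w l, y⟫_ℝ) := by
  calc ‖y‖ ^ 2 = ⟪∑ k, ⟪w k, y⟫_ℝ • w k, ∑ l, ⟪w l, y⟫_ℝ • w l⟫_ℝ := by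
        rw [h, real_inner_self_eq_norm_sq]
    _ = ∑ k, ∑ l, ⟪w k, w l⟫_ℝ * (⟪w k, y⟫_ℝ * ⟪w l, y⟫_ℝ) := by
        simp_rw [sum_inner, inner_sum, real_inner_smul_left, real_inner_smul_right]
        exact Finset.sum_congr rfl fun k _ => Finset.sum_congr rfl fun l _ => by ring

theorem abs_sum_sum_mul_le {ι : Type*} [Fintype ι] (D : ι → ι → ℝ) {a : ι → ℝ} {C : ℝ}
    (ha : ∀ k, |a k| ≤ C) :
    |∑ k, ∑ l, D k l * (a k * a l)| ≤ (∑ k, ∑ l, |D k l|) * C ^ 2 := by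
  simp_rw [Finset.sum_mul]
  refine (Finset.abs_sum_le_sum_abs _ _).trans <| Finset.sum_le_sum fun k _ =>
    (Finset.abs_sum_le_sum_abs _ _).trans <| Finset.sum_le_sum fun l _ => ?_
  rw [abs_mul, abs_mul, sq]
  have hC : 0 ≤ C := (abs_nonneg _).trans (ha k)
  gcongr <;> exact ha _

theorem mean_sum_mul_sq {ι : Type*} [Fintype ι] (f : ι → ℕ → ℝ) (a : ι → ℝ) (n : ℕ) :
    (∑ i ∈ Finset.range n, (∑ k, a k * f k i) ^ 2) / n =
      ∑ k, ∑ l, (∑ i ∈ Finset.range n, f k i * f l i) / n * (a k * a l) := by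
  simp_rw [sq, Finset.sum_mul_sum, div_mul_eq_mul_div, Finset.sum_mul, Finset.sum_div]
  rw [Finset.sum_comm]
  refine Finset.sum_congr rfl fun k _ => ?_
  rw [Finset.sum_comm]
  refine Finset.sum_congr rfl fun l _ => Finset.sum_congr rfl fun i _ => ?_
  ring

theorem memLp_id_of_isBounded_support {E : Type*} [NormedAddCommGroup E]
    [SecondCountableTopology E] [MeasurableSpace E] [OpensMeasurableSpace E] {P : Measure E}
    [IsFiniteMeasure P] (hP : Bornology.IsBounded P.support) (p : ENNReal) : MemLp id p P := by
  obtain ⟨B, hB⟩ := hP.exists_norm_le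
  refine MemLp.of_bound aestronglyMeasurable_id B ?_
  filter_upwards [P.support_mem_ae] with z hz using hB z hz

section LinearFamily

variable {V α : Type*} [AddCommGroup V] [Module ℝ V] [MeasurableSpace α] {P : Measure α}

theorem ae_forall_eq_zero_of_forall_ae [FiniteDimensional ℝ V] {T : V →ₗ[ℝ] α → ℝ}
    (hT : ∀ v, ∀ᵐ z ∂P, T v z = 0) : ∀ᵐ z ∂P, ∀ v, T v z = 0 := by
  let B := Module.finBasis ℝ V
  filter_upwards [ae_all_iff.2 fun i => hT (B i)] with z hz v
  have h : LinearMap.proj z ∘ₗ T = 0 := B.ext hz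
  exact LinearMap.congr_fun h v

/-- The linear map into `L²(P)` induced by a linear family `T` of square-integrable functions;
it turns the mean squares `∫ (T v)² ∂P` into squared norms. -/
noncomputable def linearToL2 (T : V →ₗ[ℝ] α → ℝ) (hT : ∀ v, MemLp (T v) 2 P) :
    V →ₗ[ℝ] Lp ℝ 2 P where
  toFun v := (hT v).toLp
  map_add' v w := by
    rw [← MemLp.toLp_add (hT v) (hT w)]
    exact MemLp.toLp_congr _ _ (.of_forall fun z => by rw [map_add])
  map_smul' a v := by
    rw [RingHom.id_apply, ← MemLp.toLp_const_smul a (hT v)]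
    exact MemLp.toLp_congr _ _ (.of_forall fun z => by rw [map_smul])

variable {T : V →ₗ[ℝ] α → ℝ} (hT : ∀ v, MemLp (T v) 2 P)

theorem inner_linearToL2 (v w : V) :
    ⟪linearToL2 T hT v, linearToL2 T hT w⟫_ℝ = ∫ z, T v z * T w z ∂P := by
  rw [L2.inner_def]
  refine integral_congr_ae ?_
  filter_upwards [(hT v).coeFn_toLp, (hT w).coeFn_toLp] with z hv hw
  change ⟪(hT v).toLp _ z, (hT w).toLp _ z⟫_ℝ = _
  rw [hv, hw, RCLike.inner_apply, conj_trivial, mul_comm]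

theorem norm_linearToL2_sq (v : V) : ‖linearToL2 T hT v‖ ^ 2 = ∫ z, T v z ^ 2 ∂P := by
  simp_rw [← real_inner_self_eq_norm_sq, inner_linearToL2, sq]

theorem linearToL2_eq_zero_iff {v : V} : linearToL2 T hT v = 0 ↔ ∀ᵐ z ∂P, T v z = 0 :=
  (Lp.eq_zero_iff_ae_eq_zero).trans <| (hT v).coeFn_toLp.congr_left

theorem ae_forall_eq_sum_inner_mul [FiniteDimensional ℝ V] {ι : Type*} [Fintype ι] {e : ι → V}
    (he : ∀ v, ∑ k, ⟪linearToL2 T hT (e k), linearToL2 T hT v⟫_ℝ • linearToL2 T hT (e k) =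
      linearToL2 T hT v) :
    ∀ᵐ z ∂P, ∀ v, T v z = ∑ k, ⟪linearToL2 T hT (e k), linearToL2 T hT v⟫_ℝ * T (e k) z := by
  set L := linearToL2 T hT with hL
  -- The exceptional null set must not depend on `v`: the defect of the expansion is linear in `v`.
  let defect : V →ₗ[ℝ] V :=
    LinearMap.id - ∑ k, ((innerₛₗ ℝ (L (e k))) ∘ₗ L).smulRight (e k)
  have hdefect (v : V) : defect v = v - ∑ k, ⟪L (e k), L v⟫_ℝ • e k := by
    simp [defect]
  have hzero : ∀ᵐ z ∂P, ∀ v, (T ∘ₗ defect) v z = 0 := by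
    refine ae_forall_eq_zero_of_forall_ae fun v => (linearToL2_eq_zero_iff hT).1 ?_
    rw [← hL, hdefect, map_sub, map_sum, sub_eq_zero]
    simpa only [map_smul] using (he v).symm
  filter_upwards [hzero] with z hz v
  have h := hz v
  rw [LinearMap.comp_apply, hdefect, map_sub, Pi.sub_apply, sub_eq_zero] at h
  simpa using h

end LinearFamily

section LawOfLargeNumbers

variable {α Ω : Type*} [MeasurableSpace α] [MeasurableSpace Ω] {P : Measure α} {μ : Measure Ω}
  {Z : ℕ → Ω → α}

theorem strong_law_ae_comp {g : α → ℝ} (hg : Integrable g P) (hZ_law : ∀ i, HasLaw (Z i) P μ)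
    (hZ_indep : Pairwise fun i j => Z i ⟂ᵢ[μ] Z j) :
    ∀ᵐ ω ∂μ, Tendsto (fun n : ℕ => (∑ i ∈ Finset.range n, g (Z i ω)) / n) atTop
      (𝓝 (∫ z, g z ∂P)) := by
  have hg_map (i) : AEMeasurable g (μ.map (Z i)) := (hZ_law i).map_eq ▸ hg.aemeasurable
  have hint : Integrable (g ∘ Z 0) μ :=
    ((hZ_law 0).map_eq ▸ hg : Integrable g (μ.map (Z 0))).comp_aemeasurable (hZ_law 0).aemeasurable
  rw [← (hZ_law 0).integral_comp hg.aestronglyMeasurable]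
  exact strong_law_ae_real (fun i => g ∘ Z i) hint
    (fun i j hij => (hZ_indep hij).comp₀ (hZ_law i).aemeasurable (hZ_law j).aemeasurable
      (hg_map i) (hg_map j))
    (fun i => ((hZ_law i).identDistrib (hZ_law 0)).comp_of_aemeasurable (hg_map i))

theorem ae_exists_tendsto_zero_abs_mean_sq_sub_integral_le {V : Type*} [AddCommGroup V] [Module ℝ V]
    [FiniteDimensional ℝ V] {T : V →ₗ[ℝ] α → ℝ} (hT : ∀ v, MemLp (T v) 2 P)
    (hZ_law : ∀ i, HasLaw (Z i) P μ) (hZ_indep : Pairwise fun i j => Z i ⟂ᵢ[μ] Z j) :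
    ∀ᵐ ω ∂μ, ∃ δ : ℕ → ℝ, Tendsto δ atTop (𝓝 0) ∧ ∀ n v,
      |(∑ i ∈ Finset.range n, T v (Z i ω) ^ 2) / n - ∫ z, T v z ^ 2 ∂P| ≤
        δ n * ∫ z, T v z ^ 2 ∂P := by
  set L := linearToL2 T hT
  obtain ⟨d, e, he_on, he_sum⟩ := exists_orthonormal_comp_sum_inner_smul_eq L
  have hgram : ∀ᵐ ω ∂μ, ∀ k l, Tendsto
      (fun n : ℕ => (∑ i ∈ Finset.range n, T (e k) (Z i ω) * T (e l) (Z i ω)) / n) atTop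
      (𝓝 ⟪L (e k), L (e l)⟫_ℝ) := by
    refine ae_all_iff.2 fun k => ae_all_iff.2 fun l => ?_
    rw [inner_linearToL2]
    exact strong_law_ae_comp ((hT _).integrable_mul (hT _)) hZ_law hZ_indep
  have hexpand : ∀ᵐ ω ∂μ, ∀ i v, T v (Z i ω) = ∑ k, ⟪L (e k), L v⟫_ℝ * T (e k) (Z i ω) :=
    ae_all_iff.2 fun i => ae_of_ae_map (hZ_law i).aemeasurable <| by
      rw [(hZ_law i).map_eq]
      exact ae_forall_eq_sum_inner_mul hT he_sum
  filter_upwards [hgram, hexpand] with ω hgram hexpand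
  refine ⟨fun n => ∑ k, ∑ l,
    |(∑ i ∈ Finset.range n, T (e k) (Z i ω) * T (e l) (Z i ω)) / n - ⟪L (e k), L (e l)⟫_ℝ|,
    ?_, fun n v => ?_⟩
  · rw [show (0 : ℝ) = ∑ _k : Fin d, ∑ _l : Fin d, |0| by simp]
    exact tendsto_finsetSum _ fun k _ => tendsto_finsetSum _ fun l _ =>
      (tendsto_sub_nhds_zero_iff.2 (hgram k l)).abs
  · have hcoeff (k) : |⟪L (e k), L v⟫_ℝ| ≤ ‖L v‖ := by
      simpa [he_on.1 k] using abs_real_inner_le_norm (L (e k)) (L v)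
    calc |(∑ i ∈ Finset.range n, T v (Z i ω) ^ 2) / n - ∫ z, T v z ^ 2 ∂P|
        = |∑ k, ∑ l, ((∑ i ∈ Finset.range n, T (e k) (Z i ω) * T (e l) (Z i ω)) / n -
            ⟪L (e k), L (e l)⟫_ℝ) * (⟪L (e k), L v⟫_ℝ * ⟪L (e l), L v⟫_ℝ)| := by
          simp only [fun i => hexpand i v]
          rw [mean_sum_mul_sq (fun k i => T (e k) (Z i ω)), ← norm_linearToL2_sq hT,
            norm_sq_eq_sum_inner_mul (he_sum v)]
          simp_rw [← Finset.sum_sub_distrib, ← sub_mul]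
      _ ≤ _ := by
          rw [← norm_linearToL2_sq hT]
          exact abs_sum_sum_mul_le _ hcoeff

end LawOfLargeNumbers

section AsymptoticMinimizers

variable {X : Type*} {R : X → ℝ} {Rₙ : ℕ → X → ℝ} {δ : ℕ → ℝ}

theorem tendsto_of_abs_sub_le_mul {y : X} (hδ : Tendsto δ atTop (𝓝 0))
    (hR : ∀ n, |Rₙ n y - R y| ≤ δ n * R y) : Tendsto (fun n => Rₙ n y) atTop (𝓝 (R y)) := by
  refine tendsto_iff_norm_sub_tendsto_zero.2 <| squeeze_zero (fun _ => norm_nonneg _) hR ?_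
  simpa only [zero_mul] using hδ.mul_const (R y)

theorem tendsto_sqrt_of_approx_minimizers {x : ℕ → X} {y : X} {η : ℕ → ℝ}
    (hδ : Tendsto δ atTop (𝓝 0)) (hR : ∀ n u, |Rₙ n u - R u| ≤ δ n * R u)
    (hy : ∀ u, √(R y) ≤ √(R u)) (hη : Tendsto η atTop (𝓝 0))
    (hx : ∀ᶠ n in atTop, √(Rₙ n (x n)) ≤ √(Rₙ n y) + η n) :
    Tendsto (fun n => √(R (x n))) atTop (𝓝 √(R y)) := by
  have hupper : Tendsto (fun n => (√(Rₙ n y) + η n) / √(1 - δ n)) atTop (𝓝 √(R y)) := by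
    have h := ((tendsto_of_abs_sub_le_mul hδ fun n => hR n y).sqrt.add hη).div
      (hδ.const_sub 1).sqrt (by simp)
    simpa only [sub_zero, Real.sqrt_one, add_zero, div_one, Pi.div_def] using h
  refine tendsto_of_tendsto_of_tendsto_of_le_of_le' tendsto_const_nhds hupper
    (.of_forall fun n => hy (x n)) ?_
  filter_upwards [hx, hδ.eventually_lt_const one_pos] with n hxn hδn
  rw [le_div_iff₀ (Real.sqrt_pos.2 (sub_pos.2 hδn))]
  calc √(R (x n)) * √(1 - δ n) = √((1 - δ n) * R (x n)) := by
        rw [Real.sqrt_mul (sub_pos.2 hδn).le, mul_comm]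
    _ ≤ √(Rₙ n (x n)) := Real.sqrt_le_sqrt (by linarith [(abs_le.1 (hR n (x n))).1])
    _ ≤ √(Rₙ n y) + η n := hxn

end AsymptoticMinimizers

/-- The linear family `(t, x) ↦ (t b - rᵀ x)` of functions of the observation `(b, r)`. Its member
at `(1, x)` is the residual of the predictor `x`: homogenizing in this way makes the residuals,
which are affine in `x`, part of a linear family. -/
noncomputable def residualFamily (m : ℕ) :
    (ℝ × EuclideanSpace ℝ (Fin m)) →ₗ[ℝ] Obs m → ℝ where
  toFun u z := u.1 * z.1 - ∑ j, z.2 j * u.2 j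
  map_add' u v := by
    ext z
    simp only [Prod.fst_add, Prod.snd_add, PiLp.add_apply, Pi.add_apply, mul_add,
      Finset.sum_add_distrib]
    ring
  map_smul' a u := by
    ext z
    simp only [Prod.smul_fst, Prod.smul_snd, PiLp.smul_apply, Pi.smul_apply, smul_eq_mul,
      RingHom.id_apply, mul_sub, Finset.mul_sum, mul_left_comm, mul_assoc]

section Risk

variable {m : ℕ} {P : Measure (Obs m)}

theorem residualFamily_one (x : EuclideanSpace ℝ (Fin m)) (z : Obs m) :
    residualFamily m (1, x) z = predResidual z x := by
  simp [residualFamily, predResidual]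

theorem memLp_residualFamily {p : ENNReal} (hP : MemLp id p P)
    (u : ℝ × EuclideanSpace ℝ (Fin m)) : MemLp (residualFamily m u) p P :=
  (hP.fst.const_mul u.1).sub <| memLp_finsetSum _ fun j _ =>
    ((EuclideanSpace.proj (𝕜 := ℝ) j).comp_memLp' hP.snd).mul_const (u.2 j)

theorem trueRisk_eq_norm (hP : MemLp id 2 P) (x : EuclideanSpace ℝ (Fin m)) :
    trueRisk P x = ‖linearToL2 (residualFamily m) (memLp_residualFamily hP) (1, x)‖ := by
  simp_rw [trueRisk, ← residualFamily_one]
  rw [← norm_linearToL2_sq (memLp_residualFamily hP), Real.sqrt_sq (norm_nonneg _)]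

theorem exists_isOptimalSolution (hP : MemLp id 2 P) : ∃ xP, IsOptimalSolution P xP := by
  let L := linearToL2 (residualFamily m) (memLp_residualFamily hP)
  have hrisk (x) : trueRisk P x = ‖L (1, 0) - L (0, -x)‖ := by
    rw [trueRisk_eq_norm hP, ← map_sub]
    simp [L]
  obtain ⟨xP, hxP⟩ := exists_forall_norm_sub_le (L ∘ₗ LinearMap.inr ℝ ℝ _ ∘ₗ (-LinearMap.id))
    (L (1, 0))
  exact ⟨xP, fun y => by rw [hrisk, hrisk]; exact hxP y⟩

theorem IsLassoSolution.sqrt_mean_le {c : ℝ} (hc : 0 ≤ c) {S : ℕ → Obs m} {n : ℕ}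
    {x : EuclideanSpace ℝ (Fin m)} (hx : IsLassoSolution c (fun i : Fin n => S i) x)
    (y : EuclideanSpace ℝ (Fin m)) :
    √((∑ i ∈ Finset.range n, predResidual (S i) x ^ 2) / n) ≤
      √((∑ i ∈ Finset.range n, predResidual (S i) y ^ 2) / n) + c * ∑ j, |y j| := by
  have hpenalty : 0 ≤ c * ∑ j, |x j| :=
    mul_nonneg hc (Finset.sum_nonneg fun j _ => abs_nonneg _)
  have hmin := hx y
  simp only [lassoObjective, one_div_mul_eq_div,
    Fin.sum_univ_eq_sum_range fun i => predResidual (S i) x ^ 2,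
    Fin.sum_univ_eq_sum_range fun i => predResidual (S i) y ^ 2] at hmin
  linarith

end Risk

theorem theorem7_general {m : ℕ} {P : Measure (Obs m)} (hP : MemLp id 2 P)
    {Ω : Type*} [MeasurableSpace Ω] {μ : Measure Ω} {Z : ℕ → Ω → Obs m}
    (hZ_law : ∀ i, HasLaw (Z i) P μ) (hZ_indep : Pairwise fun i j => Z i ⟂ᵢ[μ] Z j)
    {c : ℕ → ℝ} (hc_nonneg : ∀ᶠ n in atTop, 0 ≤ c n) (hc_lim : Tendsto c atTop (𝓝 0))
    {x : ℕ → Ω → EuclideanSpace ℝ (Fin m)}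
    (hx : ∀ᵐ ω ∂μ, ∀ᶠ n in atTop, IsLassoSolution (c n) (fun i : Fin n => Z i ω) (x n ω)) :
    (∃ xP, IsOptimalSolution P xP) ∧
    ∀ xP, IsOptimalSolution P xP →
      ∀ᵐ ω ∂μ, Tendsto (fun n => trueRisk P (x n ω)) atTop (𝓝 (trueRisk P xP)) := by
  refine ⟨exists_isOptimalSolution hP, fun xP hxP => ?_⟩
  filter_upwards [ae_exists_tendsto_zero_abs_mean_sq_sub_integral_le (memLp_residualFamily hP)
    hZ_law hZ_indep, hx] with ω ⟨δ, hδ, hrisk⟩ hlasso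
  have hpenalty : Tendsto (fun n => c n * ∑ j, |xP j|) atTop (𝓝 0) := by
    simpa only [zero_mul] using hc_lim.mul_const (∑ j, |xP j|)
  have hclose (n u) : |(∑ i ∈ Finset.range n, predResidual (Z i ω) u ^ 2) / n -
      ∫ z, predResidual z u ^ 2 ∂P| ≤ δ n * ∫ z, predResidual z u ^ 2 ∂P := by
    simpa only [residualFamily_one] using hrisk n (1, u)
  refine tendsto_sqrt_of_approx_minimizers (x := fun n => x n ω)
    (R := fun u => ∫ z, predResidual z u ^ 2 ∂P) hδ hclose hxP hpenalty ?_
  filter_upwards [hlasso, hc_nonneg] with n hn hcn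
  exact hn.sqrt_mean_le (S := fun i => Z i ω) hcn xP

theorem theorem7 {m : ℕ}
    -- the generating distribution: a probability with bounded support and a density
    (P : Measure (Obs m)) [IsProbabilityMeasure P]
    (hP_supp : Bornology.IsBounded P.support)
    (hP_dens : ∃ f : Obs m → ENNReal, Measurable f ∧ P = volume.withDensity f)
    -- i.i.d. observations `Z 0, Z 1, …` with law `P`
    {Ω : Type*} [MeasurableSpace Ω] (μ : Measure Ω) [IsProbabilityMeasure μ]
    (Z : ℕ → Ω → Obs m) (hZ_law : ∀ i, HasLaw (Z i) P μ) (hZ_indep : iIndepFun Z μ)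
    -- the parameters `c 1, c 2, …`
    (c : ℕ → ℝ) (hc_pos : ∀ n, 1 ≤ n → 0 < c n) (hc_anti : AntitoneOn c (Set.Ici 1))
    (hc_lim : Tendsto c atTop (𝓝 0))
    (hc_rate : Tendsto (fun n : ℕ => (n : ℝ) * c n ^ (m + 1)) atTop atTop)
    -- `x n` is any Lasso solution for the first `n` observations; these stay bounded
    (x : ℕ → Ω → EuclideanSpace ℝ (Fin m))
    (hx : ∀ᵐ ω ∂μ, ∀ n, 1 ≤ n →
      IsLassoSolution (c n) (fun i : Fin n => Z i ω) (x n ω))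
    (hx_bdd : ∀ᵐ ω ∂μ, ∃ H : ℝ, ∀ n, 1 ≤ n → ‖x n ω‖ ≤ H) :
    (∃ xP, IsOptimalSolution P xP) ∧
    ∀ xP, IsOptimalSolution P xP →
      ∀ᵐ ω ∂μ, Tendsto (fun n => trueRisk P (x n ω)) atTop (𝓝 (trueRisk P xP)) :=
  theorem7_general (memLp_id_of_isBounded_support hP_supp 2) hZ_law
    (fun _ _ hij => hZ_indep.indepFun hij)
    ((eventually_ge_atTop 1).mono fun n hn => (hc_pos n hn).le) hc_lim
    (hx.mono fun _ hω => (eventually_ge_atTop 1).mono hω)
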